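/- All groups are finite. For a finite group $G$ and a subgroup $A\le \mathrm{Aut}(G)$, let $\Gamma(G,A)$ be the graph whose vertices are the $A$-orbits $x^A$ of the nonidentity elements $x\in G$, where two distinct vertices $x^A$ and $y^A$ are joined by an edge if and only if there exist $x_1\in x^A$ and $y_1\in y^A$ that commute. A finite simple graph is called an $\mathcal F$-graph if it is connected and contains at most one vertex whose degree is at least three. Let $\mathrm{Sz}(8)$ denote the Suzuki simple group of order $29120$. Lemma. Let $G$ be a finite group having a characteristic subgroup $N$ such that $G/N\cong \mathrm{Sz}(8)$. Then there is no subgroup $A\le \mathrm{Aut}(G)$ such that $\Gamma(G,A)$ is an $\mathcal F$-graph. -/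

import Mathlib

/-- The vertices of the commuting graph of `A`-orbits on `G`: the `A`-orbits of the nonidentity
elements of `G`, where `A` acts on `G` by automorphisms. -/
abbrev NontrivialOrbit (G A : Type*) [Group G] [Group A] [MulDistribMulAction A G] : Type _ :=
  {O : Set G // ∃ x : G, x ≠ 1 ∧ O = MulAction.orbit A x}

/-- The commuting graph `Γ(G, A)` of `A`-orbits: two distinct orbits of nonidentity elements are
adjacent if and only if some element of the one commutes with some element of the other. -/
def commutingOrbitGraph (G A : Type*) [Group G] [Group A] [MulDistribMulAction A G] :
    SimpleGraph (NontrivialOrbit G A) where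
  Adj O P := O ≠ P ∧ ∃ x ∈ O.1, ∃ y ∈ P.1, Commute x y
  symm := ⟨fun _ _ ⟨hne, x, hx, y, hy, hxy⟩ => ⟨hne.symm, y, hy, x, hx, hxy.symm⟩⟩
  loopless := ⟨fun _ h => h.1 rfl⟩

/-- An `F`-graph: a finite connected simple graph with at most one vertex of degree at least
three. -/
def SimpleGraph.IsFGraph {V : Type*} (Γ : SimpleGraph V) : Prop :=
  Finite V ∧ Γ.Connected ∧ {v : V | 3 ≤ (Γ.neighborSet v).ncard}.Subsingleton

namespace Suzuki

/-- The matrix `S(a, b)`, where `θ` is the map `x ↦ x ^ (2 ^ (n + 1))`; over the field with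
`2 ^ (2 * n + 1)` elements `θ` is the automorphism whose square is the Frobenius `x ↦ x ^ 2`. -/
def lowerMatrix {K : Type*} [Field K] (n : ℕ) (a b : K) : Matrix (Fin 4) (Fin 4) K :=
  let θ : K → K := fun x => x ^ (2 ^ (n + 1))
  !![1, 0, 0, 0;
     a, 1, 0, 0;
     b, θ a, 1, 0;
     a ^ 2 * θ a + a * b + θ b, a * θ a + b, a, 1]

/-- The diagonal matrix `M(c)`, for `c ≠ 0`. -/
def diagMatrix {K : Type*} [Field K] (n : ℕ) (c : K) : Matrix (Fin 4) (Fin 4) K :=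
  Matrix.diagonal ![c ^ (1 + 2 ^ n), c ^ (2 ^ n), (c ^ (2 ^ n))⁻¹, (c ^ (1 + 2 ^ n))⁻¹]

/-- The antidiagonal permutation matrix `T`. -/
def antidiagMatrix {K : Type*} [Field K] : Matrix (Fin 4) (Fin 4) K :=
  !![0, 0, 0, 1;
     0, 0, 1, 0;
     0, 1, 0, 0;
     1, 0, 0, 0]

/-- The Suzuki group `Sz(q)`, `q = 2 ^ (2 * n + 1)`, in its standard matrix form: the subgroup of
`GL(4, q)` generated by all `S(a, b)`, all `M(c)` with `c ≠ 0`, and `T`. All of these matrices are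
invertible. -/
noncomputable def suzukiGroup (n : ℕ) : Subgroup (GL (Fin 4) (GaloisField 2 (2 * n + 1))) :=
  Subgroup.closure
    {g | (∃ a b, g.val = lowerMatrix n a b) ∨
         (∃ c, c ≠ 0 ∧ g.val = diagMatrix n c) ∨
         g.val = antidiagMatrix}

/-- The Suzuki group `Sz(8)`. -/
abbrev Sz8 : Type := suzukiGroup 1

end Suzuki

/-! ### Matrix identities and the Suzuki–Tits ovoid. -/

namespace Suzuki
section Field
variable {K : Type*} [Field K]

/-! Let `x` lie over an element of order four `S(a, b)`, `a ≠ 0`. No automorphism of Sz(8) inverts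
`S(a, b)` (`map_lower_ne_inv`), so `x` and `x⁻¹` lie in different `A`-orbits. If `x` commuted with
some `n ≠ 1` in `N`, the orbits of `x` and `x⁻¹` would be adjacent to each other and to those of `x
^ 2` and `n`: two vertices of degree at least three. Hence every such `x` acts fixed point freely on
`N` (`fixedPointFree_of_isFGraph`).

This forces `N = 1` (`ker_eq_bot_of_fixedPointFree`). Indeed `|N|` is odd, so the 2-group of all
`S(a, b)` lifts to `G`. A fixed-point-free involution inverts, and a product of two inverting
elements centralizes; playing these against each other in the lifted group leaves only `n = 1`. So
`G ≅ Sz(8)`, whose graph is disconnected, because the centralizer of a nontrivial `M(c)` is the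
torus of order seven (`not_connected_of_mulEquiv`).

The facts about Sz(8) come from its action on the Suzuki–Tits ovoid: the stabilizer of a point
consists of the `S(a, b) M(c)`, that of two points of the `M(c)`. -/

lemma lowerMatrix_one (a b : K) : lowerMatrix 1 a b =
    !![1, 0, 0, 0;
       a, 1, 0, 0;
       b, a ^ 4, 1, 0;
       a ^ 6 + a * b + b ^ 4, a ^ 5 + b, a, 1] := by
  simp only [lowerMatrix]
  norm_num
  constructor <;> ring

lemma diagMatrix_one (c : K) : diagMatrix 1 c =
    !![c ^ 3, 0, 0, 0;
       0, c ^ 2, 0, 0;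
       0, 0, (c ^ 2)⁻¹, 0;
       0, 0, 0, (c ^ 3)⁻¹] := by
  ext i j
  fin_cases i <;> fin_cases j <;> simp [diagMatrix]

lemma lowerMatrix_zero : lowerMatrix 1 (0 : K) 0 = 1 := by
  rw [lowerMatrix_one]
  ext i j
  fin_cases i <;> fin_cases j <;> simp

lemma diagMatrix_mul (c d : K) : diagMatrix 1 c * diagMatrix 1 d = diagMatrix 1 (c * d) := by
  rw [diagMatrix_one, diagMatrix_one, diagMatrix_one]
  ext i j
  fin_cases i <;> fin_cases j <;> simp [Matrix.mul_apply, Fin.sum_univ_four, mul_pow, mul_comm]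

lemma diagMatrix_one_eq_one : diagMatrix 1 (1 : K) = 1 := by
  rw [diagMatrix_one]
  ext i j
  fin_cases i <;> fin_cases j <;> simp

/-- The fourth coordinate of the affine point of the Suzuki–Tits ovoid over `F₈` with coordinates
`a` and `b`. -/
def ovoidForm (a b : K) : K := a ^ 6 + a * b + b ^ 4

/-- The cone over the Suzuki–Tits ovoid, without the origin. -/
def ovoidCone : Set (Fin 4 → K) :=
  {v | ∃ l : K, l ≠ 0 ∧ (v = ![0, 0, 0, l] ∨
    ∃ a b, v = ![l, l * a, l * b, l * ovoidForm a b])}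

/-- The matrices that preserve the alternating form with Gram matrix `antidiagMatrix` and the
Suzuki–Tits ovoid. -/
def PreservesOvoid (g : Matrix (Fin 4) (Fin 4) K) : Prop :=
  g.transpose * antidiagMatrix * g = antidiagMatrix ∧ ∀ v ∈ ovoidCone, g.mulVec v ∈ ovoidCone

lemma PreservesOvoid.one : PreservesOvoid (1 : Matrix (Fin 4) (Fin 4) K) := by
  simp [PreservesOvoid]

lemma PreservesOvoid.mul {g h : Matrix (Fin 4) (Fin 4) K} (hg : PreservesOvoid g)
    (hh : PreservesOvoid h) : PreservesOvoid (g * h) := by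
  refine ⟨?_, fun v hv => ?_⟩
  · rw [Matrix.transpose_mul]
    calc _ = h.transpose * (g.transpose * antidiagMatrix * g) * h := by noncomm_ring
      _ = _ := by rw [hg.1, hh.1]
  · rw [← Matrix.mulVec_mulVec]
    exact hg.2 _ (hh.2 _ hv)

lemma pow_seven_eq_one (h8 : ∀ x : K, x ^ 8 = x) {c : K} (hc : c ≠ 0) : c ^ 7 = 1 :=
  mul_left_cancel₀ hc (by linear_combination h8 c)

/-- For `x ≠ 0, 1` the diagonal entries `x ^ 3, x ^ 2, x ^ 5, x ^ 4` of `M(x)` are distinct. -/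
lemma apply_eq_zero_of_commute_diagMatrix (h8 : ∀ x : K, x ^ 8 = x) {x : K} (hx0 : x ≠ 0)
    (hx1 : x ≠ 1) {g : Matrix (Fin 4) (Fin 4) K}
    (h : g * diagMatrix 1 x = diagMatrix 1 x * g) {i j : Fin 4} (hij : i ≠ j) : g i j = 0 := by
  have h7 := pow_seven_eq_one h8 hx0
  have key := congrFun (congrFun h i) j
  have hi2 : (x ^ 2)⁻¹ = x ^ 5 := by field_simp; linear_combination -h7
  have hi3 : (x ^ 3)⁻¹ = x ^ 4 := by field_simp; linear_combination -h7
  have x2 : x ^ 2 ≠ 1 := fun e => hx1 (by grind)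
  have x3 : x ^ 3 ≠ 1 := fun e => hx1 (by grind)
  have hd : ![x ^ 3, x ^ 2, x ^ 5, x ^ 4] j ≠ ![x ^ 3, x ^ 2, x ^ 5, x ^ 4] i := by
    fin_cases i <;> fin_cases j <;> first | exact absurd rfl hij | (simp; grind)
  have e : diagMatrix 1 x = Matrix.diagonal ![x ^ 3, x ^ 2, x ^ 5, x ^ 4] := by
    simp [diagMatrix, hi2, hi3]
  rw [e, Matrix.mul_diagonal, Matrix.diagonal_mul] at key
  have : g i j * (![x ^ 3, x ^ 2, x ^ 5, x ^ 4] j - ![x ^ 3, x ^ 2, x ^ 5, x ^ 4] i) = 0 := by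
    linear_combination key
  exact (mul_eq_zero.1 this).resolve_right (sub_ne_zero.2 hd)

/-- A nontrivial element `S(a, b)` fixes only one point of the ovoid. -/
lemma eq_of_lowerMatrix_fixes {a b : K} (hab : ¬(a = 0 ∧ b = 0)) {v : Fin 4 → K}
    (hv : v ∈ ovoidCone) (h : (lowerMatrix 1 a b).mulVec v = v) :
    ∃ l, v = ![0, 0, 0, l] := by
  obtain ⟨l, hl, rfl | ⟨c, d, rfl⟩⟩ := hv
  · exact ⟨l, rfl⟩
  · rw [lowerMatrix_one] at h
    have e1 := congrFun h 1
    have e2 := congrFun h 2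
    simp [Matrix.mulVec, dotProduct, Fin.sum_univ_four] at e1 e2
    have ha : a = 0 := by simpa [hl] using e1
    subst ha
    exact absurd ⟨rfl, by simpa [hl] using e2⟩ hab

variable [CharP K 2]

lemma lowerMatrix_mul (h8 : ∀ x : K, x ^ 8 = x) (a b c d : K) :
    lowerMatrix 1 a b * lowerMatrix 1 c d = lowerMatrix 1 (a + c) (b + d + a ^ 4 * c) := by
  have h2 : (2 : K) = 0 := CharTwo.two_eq_zero
  have ha := h8 a
  have hc := h8 c
  rw [lowerMatrix_one, lowerMatrix_one, lowerMatrix_one]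
  ext i j
  fin_cases i <;> fin_cases j <;> simp [Matrix.mul_apply, Fin.sum_univ_four] <;> grind

lemma diagMatrix_mul_lowerMatrix (h8 : ∀ x : K, x ^ 8 = x) {c : K} (hc : c ≠ 0) (a b : K) :
    diagMatrix 1 c * lowerMatrix 1 a b =
      lowerMatrix 1 (c⁻¹ * a) (c ^ 2 * b) * diagMatrix 1 c := by
  have h7 := pow_seven_eq_one h8 hc
  have hi : c⁻¹ = c ^ 6 := by field_simp; linear_combination -h7
  have hi2 : (c ^ 2)⁻¹ = c ^ 5 := by field_simp; linear_combination -h7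
  have hi3 : (c ^ 3)⁻¹ = c ^ 4 := by field_simp; linear_combination -h7
  rw [lowerMatrix_one, lowerMatrix_one, diagMatrix_one, hi, hi2, hi3]
  ext i j
  fin_cases i <;> fin_cases j <;> simp [Matrix.mul_apply, Fin.sum_univ_four] <;> grind

/-- With `f = ovoidForm a b`, this is `f * ovoidForm (b / f) (a / f) = 1` with denominators cleared,
which is what makes `T` preserve the ovoid. -/
lemma ovoidForm_swap (h8 : ∀ x : K, x ^ 8 = x) (a b : K) :
    ovoidForm a b ^ 5 =
      b ^ 6 + a * b * ovoidForm a b ^ 4 + a ^ 4 * ovoidForm a b ^ 2 := by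
  have h2 : (2 : K) = 0 := CharTwo.two_eq_zero
  have ha := h8 a
  have hb := h8 b
  have e2 : ovoidForm a b ^ 2 = a ^ 5 + a ^ 2 * b ^ 2 + b := by
    unfold ovoidForm
    grind
  have e4 : ovoidForm a b ^ 4 = a ^ 3 + a ^ 4 * b ^ 4 + b ^ 2 := by
    rw [show ovoidForm a b ^ 4 = (ovoidForm a b ^ 2) ^ 2 by ring, e2]
    grind
  rw [show ovoidForm a b ^ 5 = ovoidForm a b ^ 4 * ovoidForm a b by ring, e4, e2]
  unfold ovoidForm
  grind

lemma lowerMatrix_mulVec_mem_ovoidCone (h8 : ∀ x : K, x ^ 8 = x) (a b : K) {v : Fin 4 → K}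
    (hv : v ∈ ovoidCone) : (lowerMatrix 1 a b).mulVec v ∈ ovoidCone := by
  have h2 : (2 : K) = 0 := CharTwo.two_eq_zero
  have ha := h8 a
  obtain ⟨l, hl, rfl | ⟨c, d, rfl⟩⟩ := hv
  · refine ⟨l, hl, Or.inl ?_⟩
    rw [lowerMatrix_one]
    ext i
    fin_cases i <;> simp [Matrix.mulVec, dotProduct, Fin.sum_univ_four]
  · refine ⟨l, hl, Or.inr ⟨a + c, b + d + a ^ 4 * c, ?_⟩⟩
    have hc := h8 c
    rw [lowerMatrix_one]
    unfold ovoidForm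
    ext i
    fin_cases i <;> simp [Matrix.mulVec, dotProduct, Fin.sum_univ_four] <;> grind

lemma diagMatrix_mulVec_mem_ovoidCone (h8 : ∀ x : K, x ^ 8 = x) {c : K} (hc : c ≠ 0)
    {v : Fin 4 → K} (hv : v ∈ ovoidCone) : (diagMatrix 1 c).mulVec v ∈ ovoidCone := by
  have h7 := pow_seven_eq_one h8 hc
  have hi : c⁻¹ = c ^ 6 := by field_simp; linear_combination -h7
  have hi2 : (c ^ 2)⁻¹ = c ^ 5 := by field_simp; linear_combination -h7
  have hi3 : (c ^ 3)⁻¹ = c ^ 4 := by field_simp; linear_combination -h7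
  obtain ⟨l, hl, rfl | ⟨a, b, rfl⟩⟩ := hv
  · refine ⟨(c ^ 3)⁻¹ * l, by positivity, Or.inl ?_⟩
    rw [diagMatrix_one]
    ext i
    fin_cases i <;> simp [Matrix.mulVec, dotProduct, Fin.sum_univ_four]
  · refine ⟨c ^ 3 * l, by positivity, Or.inr ⟨c ^ 6 * a, c ^ 2 * b, ?_⟩⟩
    rw [diagMatrix_one, hi2, hi3]
    unfold ovoidForm
    ext i
    fin_cases i <;> simp [Matrix.mulVec, dotProduct, Fin.sum_univ_four] <;> grind

lemma antidiagMatrix_mulVec_mem_ovoidCone (h8 : ∀ x : K, x ^ 8 = x)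
    {v : Fin 4 → K} (hv : v ∈ ovoidCone) : antidiagMatrix.mulVec v ∈ ovoidCone := by
  obtain ⟨l, hl, rfl | ⟨a, b, rfl⟩⟩ := hv
  · refine ⟨l, hl, Or.inr ⟨0, 0, ?_⟩⟩
    unfold ovoidForm antidiagMatrix
    ext i
    fin_cases i <;> simp [Matrix.mulVec, dotProduct, Fin.sum_univ_four]
  · have key := ovoidForm_swap h8 a b
    by_cases hf : ovoidForm a b = 0
    · have hb : b = 0 := by
        rw [hf] at key
        simpa using key.symm
      have ha : a = 0 := by
        subst hb
        simpa [ovoidForm] using hf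
      refine ⟨l, hl, Or.inl ?_⟩
      subst ha hb
      unfold ovoidForm antidiagMatrix
      ext i
      fin_cases i <;> simp [Matrix.mulVec, dotProduct, Fin.sum_univ_four]
    · refine ⟨l * ovoidForm a b, mul_ne_zero hl hf,
        Or.inr ⟨b / ovoidForm a b, a / ovoidForm a b, ?_⟩⟩
      have h3 : ovoidForm a b * ovoidForm (b / ovoidForm a b) (a / ovoidForm a b) = 1 := by
        rw [ovoidForm.eq_1 (b / _)]
        field_simp
        linear_combination -key
      unfold antidiagMatrix
      ext i
      fin_cases i <;> simp [Matrix.mulVec, dotProduct, Fin.sum_univ_four, mul_assoc, h3,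
        mul_div_cancel₀, hf]

lemma preservesOvoid_lowerMatrix (h8 : ∀ x : K, x ^ 8 = x) (a b : K) :
    PreservesOvoid (lowerMatrix 1 a b) := by
  refine ⟨?_, fun v hv => lowerMatrix_mulVec_mem_ovoidCone h8 a b hv⟩
  have h2 : (2 : K) = 0 := CharTwo.two_eq_zero
  rw [lowerMatrix_one]
  unfold antidiagMatrix
  ext i j
  fin_cases i <;> fin_cases j <;> simp [Matrix.mul_apply, Fin.sum_univ_four] <;> grind

lemma preservesOvoid_diagMatrix (h8 : ∀ x : K, x ^ 8 = x) {c : K} (hc : c ≠ 0) :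
    PreservesOvoid (diagMatrix 1 c) := by
  refine ⟨?_, fun v hv => diagMatrix_mulVec_mem_ovoidCone h8 hc hv⟩
  rw [diagMatrix_one]
  unfold antidiagMatrix
  ext i j
  fin_cases i <;> fin_cases j <;> simp [Matrix.mul_apply, Fin.sum_univ_four, hc]

lemma preservesOvoid_antidiagMatrix (h8 : ∀ x : K, x ^ 8 = x) :
    PreservesOvoid (antidiagMatrix : Matrix (Fin 4) (Fin 4) K) := by
  refine ⟨?_, fun v hv => antidiagMatrix_mulVec_mem_ovoidCone h8 hv⟩
  unfold antidiagMatrix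
  ext i j
  fin_cases i <;> fin_cases j <;> simp [Matrix.mul_apply, Fin.sum_univ_four]

/-! ### Equations over F₈ and point stabilizers of the ovoid. -/

lemma exists_primitive (h8 : ∀ x : K, x ^ 8 = x) (hK : ∃ y : K, y ≠ 0 ∧ y ≠ 1) :
    ∃ w : K, w ^ 3 = w + 1 := by
  have h2 : (2 : K) = 0 := CharTwo.two_eq_zero
  obtain ⟨y, h0, h1⟩ := hK
  have h7 := pow_seven_eq_one h8 h0
  have : (y - 1) * ((y ^ 3 + y + 1) * (y ^ 3 + y ^ 2 + 1)) = 0 := by grind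
  rcases mul_eq_zero.1 ((mul_eq_zero.1 this).resolve_left (sub_ne_zero.2 h1)) with h | h
  · exact ⟨y, by grind⟩
  · exact ⟨y⁻¹, by field_simp; grind⟩

/-- Squaring would give `1 + c + c ^ 2 = 0`, hence `c ^ 3 = 1`, which is incompatible with `c ^ 8 =
c`. -/
lemma add_pow_four_ne_one (h8 : ∀ x : K, x ^ 8 = x) (c : K) : 1 + c + c ^ 4 ≠ 0 := by
  have h2 : (2 : K) = 0 := CharTwo.two_eq_zero
  have hc := h8 c
  intro h
  have h1 : 1 + c + c ^ 2 = 0 := by grind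
  have h3 : c ^ 3 = 1 := by grind
  grind

lemma eq_zero_of_binary (h8 : ∀ x : K, x ^ 8 = x) {w : K} (hw : w ^ 3 = w + 1) {A B C : K}
    (h : ∀ b, A * b ^ 6 + B * b ^ 2 + C * b ^ 4 = 0) : A = 0 ∧ B = 0 ∧ C = 0 := by
  have h2 : (2 : K) = 0 := CharTwo.two_eq_zero
  have e1 := h 1
  have e2 := h w
  have e3 := h (w ^ 2)
  have p4 : w ^ 4 = w ^ 2 + w := by grind
  have p6 : w ^ 6 = w ^ 2 + 1 := by grind
  have p8 := h8 w
  have p12 : (w ^ 2) ^ 6 = w ^ 2 + w + 1 := by grind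
  have p8' : (w ^ 2) ^ 4 = w := by grind
  rw [p6, p4] at e2
  rw [p12, p8', show (w ^ 2) ^ 2 = w ^ 2 + w by grind] at e3
  have hC : C = A + B := by grind
  have hA : A = 0 := by grind
  have hB : B = 0 := by
    have : B * w = 0 := by grind
    rcases mul_eq_zero.1 this with h | h
    · exact h
    · grind
  exact ⟨hA, hB, by grind⟩

/-- On each axis the invariance compares the functions `b ^ 6`, `b ^ 2`, `b ^ 4`, which are linearly
independent on F₈. -/
lemma linear_ovoidForm_invariant (h8 : ∀ x : K, x ^ 8 = x) {w : K} (hw : w ^ 3 = w + 1)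
    {P Q R S l : K} (hl : l ≠ 0) (hdet : P * S + R * Q = l ^ 2)
    (h : ∀ a b, ovoidForm (P * a + Q * b) (R * a + S * b) = l ^ 2 * ovoidForm a b) :
    P = l ^ 5 ∧ Q = 0 ∧ R = 0 ∧ S = l ^ 4 := by
  have h2 : (2 : K) = 0 := CharTwo.two_eq_zero
  have h7 := pow_seven_eq_one h8 hl
  unfold ovoidForm at h
  obtain ⟨hQ, -, hS⟩ := eq_zero_of_binary h8 hw (A := Q ^ 6) (B := Q * S) (C := S ^ 4 - l ^ 2)
    fun b => by have := h 0 b; linear_combination this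
  replace hQ : Q = 0 := by simpa using hQ
  subst hQ
  have hS' : S = l ^ 4 := by
    rw [← h8 S, show S ^ 8 = (S ^ 4) ^ 2 by ring, sub_eq_zero.1 hS]
    ring
  have hP : P = l ^ 5 := by
    have : l ^ 4 * P = l ^ 4 * l ^ 5 := by grind
    exact mul_left_cancel₀ (pow_ne_zero _ hl) this
  subst hS' hP
  obtain ⟨-, hR, -⟩ := eq_zero_of_binary h8 hw (A := (l ^ 5) ^ 6 - l ^ 2) (B := l ^ 5 * R)
    (C := R ^ 4) fun a => by have := h a 0; linear_combination this
  exact ⟨rfl, rfl, (mul_eq_zero.1 hR).resolve_left (pow_ne_zero _ hl), rfl⟩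

/-- The form makes `g` block diagonal with blocks of size 1, 2, 1; invariance of the ovoid equation
then fixes the middle block in terms of `l`. -/
lemma PreservesOvoid.eq_diagMatrix (h8 : ∀ x : K, x ^ 8 = x) {w : K} (hw : w ^ 3 = w + 1)
    {g : Matrix (Fin 4) (Fin 4) K} (hg : PreservesOvoid g) {m l : K}
    (h1 : g.mulVec ![1, 0, 0, 0] = ![m, 0, 0, 0]) (h4 : g.mulVec ![0, 0, 0, 1] = ![0, 0, 0, l]) :
    ∃ c, c ≠ 0 ∧ g = diagMatrix 1 c := by
  have h2 : (2 : K) = 0 := CharTwo.two_eq_zero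
  obtain ⟨hf, ho⟩ := hg
  have c1 : ∀ i, g i 0 = ![m, 0, 0, 0] i := fun i => by
    rw [← h1]; simp [Matrix.mulVec, dotProduct, Fin.sum_univ_four]
  have c4 : ∀ i, g i 3 = ![0, 0, 0, l] i := fun i => by
    rw [← h4]; simp [Matrix.mulVec, dotProduct, Fin.sum_univ_four]
  have f := fun i j => congrFun (congrFun hf i) j
  simp only [Matrix.mul_apply, Fin.sum_univ_four, Matrix.transpose_apply, antidiagMatrix] at f
  have a0 := c1 0
  have a1 := c1 1
  have a2 := c1 2
  have a3 := c1 3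
  have b0 := c4 0
  have b1 := c4 1
  have b2 := c4 2
  have b3 := c4 3
  simp at a0 a1 a2 a3 b0 b1 b2 b3
  have f03 := f 0 3
  have f01 := f 0 1
  have f02 := f 0 2
  have f31 := f 3 1
  have f32 := f 3 2
  have f12 := f 1 2
  simp [a0, a1, a2, a3, b0, b1, b2, b3] at f03 f01 f02 f31 f32 f12
  have hm : m ≠ 0 := by rintro rfl; simp at f03
  have hl : l ≠ 0 := by rintro rfl; simp at f03
  replace f01 := f01.resolve_left hm
  replace f02 := f02.resolve_left hm
  replace f31 := f31.resolve_left hl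
  replace f32 := f32.resolve_left hl
  have l7 := pow_seven_eq_one h8 hl
  have hm' : m = l ^ 6 := mul_right_cancel₀ hl (by linear_combination f03 - l7)
  obtain ⟨hp, hq, hr, hs⟩ := linear_ovoidForm_invariant h8 hw (P := l * g 1 1) (Q := l * g 1 2)
    (R := l * g 2 1) (S := l * g 2 2) hl (by
      simp [f01, f02, f31, f32] at f12
      linear_combination l ^ 2 * f12) (fun a b => by
      obtain ⟨k, hk, h | ⟨c, d, h⟩⟩ := ho ![1, a, b, ovoidForm a b]
        ⟨1, one_ne_zero, Or.inr ⟨a, b, by simp⟩⟩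
      · have := congrFun h 0
        simp [Matrix.mulVec, dotProduct, Fin.sum_univ_four, a0, b0, f31, f32, hm] at this
      · have e0 := congrFun h 0
        have e1 := congrFun h 1
        have e2 := congrFun h 2
        have e3 := congrFun h 3
        simp [Matrix.mulVec, dotProduct, Fin.sum_univ_four, a0, a1, a2, a3, b0, b1, b2, b3,
          f01, f02, f31, f32] at e0 e1 e2 e3
        have hc : l * g 1 1 * a + l * g 1 2 * b = c := by
          rw [← e0] at e1; linear_combination l * e1 + c * f03
        have hd : l * g 2 1 * a + l * g 2 2 * b = d := by
          rw [← e0] at e2; linear_combination l * e2 + d * f03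
        rw [hc, hd]
        rw [← e0] at e3
        linear_combination - ovoidForm c d * f03 - l * e3)
  refine ⟨l ^ 2, pow_ne_zero _ hl, ?_⟩
  replace hp : g 1 1 = l ^ 4 := mul_left_cancel₀ hl (by linear_combination hp)
  replace hs : g 2 2 = l ^ 3 := mul_left_cancel₀ hl (by linear_combination hs)
  replace hq : g 1 2 = 0 := (mul_eq_zero.1 hq).resolve_left hl
  replace hr : g 2 1 = 0 := (mul_eq_zero.1 hr).resolve_left hl
  rw [diagMatrix_one]
  ext i j
  fin_cases i <;> fin_cases j <;> simp [*] <;> field_simp <;> grind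

/-- The `S(a, b)` are transitive on the points other than `[0, 0, 0, 1]`, which reduces to the
stabilizer of two points. -/
lemma PreservesOvoid.eq_lowerMatrix_mul_diagMatrix (h8 : ∀ x : K, x ^ 8 = x) {w : K}
    (hw : w ^ 3 = w + 1) {g : Matrix (Fin 4) (Fin 4) K} (hg : PreservesOvoid g) {l : K}
    (h4 : g.mulVec ![0, 0, 0, 1] = ![0, 0, 0, l]) :
    ∃ a b c, c ≠ 0 ∧ g = lowerMatrix 1 a b * diagMatrix 1 c := by
  have h2 : (2 : K) = 0 := CharTwo.two_eq_zero
  have c4 : ∀ i, g i 3 = ![0, 0, 0, l] i := fun i => by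
    rw [← h4]; simp [Matrix.mulVec, dotProduct, Fin.sum_univ_four]
  obtain ⟨m, hm, h | ⟨a, b, h⟩⟩ := hg.2 ![1, 0, 0, 0]
    ⟨1, one_ne_zero, Or.inr ⟨0, 0, by simp [ovoidForm]⟩⟩
  · have c1 : ∀ i, g i 0 = ![0, 0, 0, m] i := fun i => by
      rw [← h]; simp [Matrix.mulVec, dotProduct, Fin.sum_univ_four]
    have f := congrFun (congrFun hg.1 0) 3
    simp [Matrix.mul_apply, Fin.sum_univ_four, antidiagMatrix, c1, c4] at f
  -- `S(a, b + a ^ 5)` is the inverse of `S(a, b)`; it carries the image of `[1, 0, 0, 0]` back to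
  -- that point.
  · obtain ⟨c, hc, he⟩ := PreservesOvoid.eq_diagMatrix h8 hw
      ((preservesOvoid_lowerMatrix h8 a (b + a ^ 5)).mul hg) (m := m) (l := l) (by
        have ha := h8 a
        rw [← Matrix.mulVec_mulVec, h, lowerMatrix_one]
        unfold ovoidForm
        ext i
        fin_cases i <;> simp [Matrix.mulVec, dotProduct, Fin.sum_univ_four] <;> grind) (by
        rw [← Matrix.mulVec_mulVec, h4, lowerMatrix_one]
        ext i
        fin_cases i <;> simp [Matrix.mulVec, dotProduct, Fin.sum_univ_four])
    refine ⟨a, b, c, hc, ?_⟩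
    rw [← he, ← mul_assoc, lowerMatrix_mul h8, show a + a = 0 by grind,
      show b + (b + a ^ 5) + a ^ 4 * a = 0 by grind, lowerMatrix_zero, one_mul]

/-- `g` carries a fixed point of `S(a', b')` to one of `S(a, b)`, and the only one there is `[0, 0,
0, 1]`. -/
lemma PreservesOvoid.eq_of_lowerMatrix_mul (h8 : ∀ x : K, x ^ 8 = x) {w : K}
    (hw : w ^ 3 = w + 1) {g : Matrix (Fin 4) (Fin 4) K} (hg : PreservesOvoid g) {a b a' b' : K}
    (hab : ¬(a = 0 ∧ b = 0)) (h : lowerMatrix 1 a b * g = g * lowerMatrix 1 a' b') :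
    ∃ p q c, c ≠ 0 ∧ g = lowerMatrix 1 p q * diagMatrix 1 c := by
  have h4 : (lowerMatrix 1 a' b').mulVec ![0, 0, 0, 1] = ![0, 0, 0, 1] := by
    rw [lowerMatrix_one]
    ext i
    fin_cases i <;> simp [Matrix.mulVec, dotProduct, Fin.sum_univ_four]
  obtain ⟨l, hl⟩ := eq_of_lowerMatrix_fixes hab
    (hg.2 ![0, 0, 0, 1] ⟨1, one_ne_zero, Or.inl rfl⟩)
    (by rw [Matrix.mulVec_mulVec, h, ← Matrix.mulVec_mulVec, h4])
  exact hg.eq_lowerMatrix_mul_diagMatrix h8 hw hl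

lemma false_of_inverted_relation (h8 : ∀ x : K, x ^ 8 = x) {d p : K} (hd : d ≠ 0)
    (h1 : 1 + d + d ^ 3 = 0)
    (h : 1 + (d ^ 5 + p ^ 4 * d + p * d ^ 4) + d +
      (d ^ 5 * (d ^ 5 * (d ^ 5 + p ^ 4 * d + p * d ^ 4) + p ^ 4 * d ^ 2 + p * d ^ 8) +
        p ^ 4 * d ^ 3 + p * d ^ 12) + (1 + d) ^ 4 * d ^ 3 = 0) : False := by
  have h2 : (2 : K) = 0 := CharTwo.two_eq_zero
  have h7 := pow_seven_eq_one h8 hd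
  have hp := h8 p
  have hd3 : d ^ 3 = 1 + d := by grind
  have : d ^ 2 * (1 + p * d ^ 5 + (p * d ^ 5) ^ 4) = 0 := by
    have e : (p * d ^ 5) ^ 4 = p ^ 4 * d ^ 6 := by
      linear_combination p ^ 4 * d ^ 6 * (d ^ 7 + 1) * h7
    rw [e]
    grind
  exact add_pow_four_ne_one h8 (p * d ^ 5)
    ((mul_eq_zero.1 this).resolve_left (pow_ne_zero _ hd))

end Field

/-! ### Sz(8) as a group preserving the ovoid. -/

/-- The field with eight elements over which `Sz(8)` is defined. -/
abbrev F8 : Type := GaloisField 2 (2 * 1 + 1)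

lemma F8.pow_eight (x : F8) : x ^ 8 = x := by
  have := Fintype.ofFinite F8
  have h := FiniteField.pow_card x
  rwa [← Nat.card_eq_fintype_card, GaloisField.card 2 _ (by norm_num),
    show 2 ^ (2 * 1 + 1) = 8 by norm_num] at h

lemma F8.exists_primitive : ∃ w : F8, w ^ 3 = w + 1 := by
  refine Suzuki.exists_primitive F8.pow_eight ?_
  have h : Nat.card F8 = 8 := by
    rw [GaloisField.card 2 _ (by norm_num)]; norm_num
  by_contra! hc
  have : (Set.univ : Set F8) ⊆ {0, 1} := fun y _ => by
    by_cases h0 : y = 0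
    · exact Or.inl h0
    · exact Or.inr (hc y h0)
  have := Set.ncard_le_ncard this
  rw [Set.ncard_univ, h, Set.ncard_pair zero_ne_one] at this
  omega

lemma preservesOvoid_of_mem {g : GL (Fin 4) F8} (hg : g ∈ suzukiGroup 1) :
    PreservesOvoid g.1 := by
  unfold suzukiGroup at hg
  induction hg using Subgroup.closure_induction with
  | mem x hx =>
    rcases hx with ⟨a, b, h⟩ | ⟨c, hc, h⟩ | h
    · rw [h]; exact preservesOvoid_lowerMatrix F8.pow_eight a b
    · rw [h]; exact preservesOvoid_diagMatrix F8.pow_eight hc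
    · rw [h]; exact preservesOvoid_antidiagMatrix F8.pow_eight
  | one => exact PreservesOvoid.one
  | mul x y _ _ hx hy => exact hx.mul hy
  | inv x _ hx =>
    -- In a finite group the inverse is a power.
    have hpow : ∀ n : ℕ, PreservesOvoid (x ^ n).1 := fun n => by
      induction n with
      | zero => rw [pow_zero]; exact PreservesOvoid.one
      | succ n ih => rw [pow_succ]; exact ih.mul hx
    have : x⁻¹ = x ^ (orderOf x - 1) := by
      rw [inv_eq_iff_mul_eq_one, ← pow_succ', Nat.sub_add_cancel (orderOf_pos x),
        pow_orderOf_eq_one]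
    rw [this]
    exact hpow _

/-- The element `S(a, b)` of `Sz(8)`. -/
noncomputable def Sz8.lower (a b : F8) : Sz8 :=
  ⟨⟨lowerMatrix 1 a b, lowerMatrix 1 a (b + a ^ 5), by
    rw [lowerMatrix_mul F8.pow_eight, CharTwo.add_self_eq_zero,
      show b + (b + a ^ 5) + a ^ 4 * a = (b + b) + (a ^ 5 + a ^ 5) by ring,
      CharTwo.add_self_eq_zero, CharTwo.add_self_eq_zero, add_zero, lowerMatrix_zero], by
    rw [lowerMatrix_mul F8.pow_eight, CharTwo.add_self_eq_zero,
      show b + a ^ 5 + b + a ^ 4 * a = (b + b) + (a ^ 5 + a ^ 5) by ring,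
      CharTwo.add_self_eq_zero, CharTwo.add_self_eq_zero, add_zero, lowerMatrix_zero]⟩,
    Subgroup.subset_closure (Or.inl ⟨a, b, rfl⟩)⟩

/-- The element `M(c)` of `Sz(8)`. -/
noncomputable def Sz8.diag (c : F8ˣ) : Sz8 :=
  ⟨⟨diagMatrix 1 (c : F8), diagMatrix 1 ((c⁻¹ : F8ˣ) : F8), by
    rw [diagMatrix_mul, Units.mul_inv, diagMatrix_one_eq_one], by
    rw [diagMatrix_mul, Units.inv_mul, diagMatrix_one_eq_one]⟩,
    Subgroup.subset_closure (Or.inr (Or.inl ⟨c, c.ne_zero, rfl⟩))⟩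

/-! ### Centralizers and automorphisms of Sz(8). -/

namespace Sz8

lemma ext_matrix {g h : Sz8} (H : g.1.1 = h.1.1) : g = h := Subtype.ext (Units.ext H)

lemma val_lower (a b : F8) : (lower a b).1.1 = lowerMatrix 1 a b := rfl

lemma val_diag (c : F8ˣ) :
    (diag c).1.1 = diagMatrix 1 (c : F8) := rfl

lemma val_mul (g h : Sz8) : (g * h).1.1 = g.1.1 * h.1.1 := rfl

lemma lower_mul (a b c d : F8) :
    lower a b * lower c d = lower (a + c) (b + d + a ^ 4 * c) :=
  ext_matrix (lowerMatrix_mul F8.pow_eight a b c d)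

lemma lower_zero : lower 0 0 = 1 := ext_matrix lowerMatrix_zero

lemma lower_inj {a b c d : F8} :
    lower a b = lower c d ↔ a = c ∧ b = d := by
  refine ⟨fun h => ?_, fun h => by rw [h.1, h.2]⟩
  have h' := congrArg (fun g : Sz8 => g.1.1) h
  simp only [val_lower, lowerMatrix_one] at h'
  have h1 := congrFun (congrFun h' 1) 0
  have h2 := congrFun (congrFun h' 2) 0
  exact ⟨by simpa using h1, by simpa using h2⟩

lemma lower_eq_one {a b : F8} : lower a b = 1 ↔ a = 0 ∧ b = 0 := by
  rw [← lower_zero, lower_inj]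

lemma lower_inv (a b : F8) : (lower a b)⁻¹ = lower a (b + a ^ 5) := by
  rw [inv_eq_iff_mul_eq_one, lower_mul, lower_eq_one]
  refine ⟨CharTwo.add_self_eq_zero a, ?_⟩
  rw [show b + (b + a ^ 5) + a ^ 4 * a = (b + b) + (a ^ 5 + a ^ 5) by ring,
      CharTwo.add_self_eq_zero, CharTwo.add_self_eq_zero, add_zero]

lemma lower_mul_self (a b : F8) :
    lower a b * lower a b = lower 0 (a ^ 5) := by
  rw [lower_mul, CharTwo.add_self_eq_zero, CharTwo.add_self_eq_zero, zero_add, ← pow_succ]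

lemma diag_mul (c d : F8ˣ) : diag c * diag d = diag (c * d) :=
  ext_matrix (by rw [val_mul, val_diag, val_diag, val_diag, diagMatrix_mul, Units.val_mul])

lemma diag_one : diag 1 = 1 :=
  ext_matrix (by rw [val_diag, Units.val_one, diagMatrix_one_eq_one]; rfl)

lemma diag_mul_lower (c : F8ˣ) (a b : F8) :
    diag c * lower a b =
      lower ((c : F8)⁻¹ * a) ((c : F8) ^ 2 * b) *
        diag c :=
  ext_matrix (diagMatrix_mul_lowerMatrix F8.pow_eight c.ne_zero a b)

lemma eq_lower_mul_diag {g : Sz8} {a b a' b' : F8}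
    (hab : ¬(a = 0 ∧ b = 0)) (h : lower a b * g = g * lower a' b') :
    ∃ p q c, g = lower p q * diag c := by
  obtain ⟨w, hw⟩ := F8.exists_primitive
  obtain ⟨p, q, c, hc, e⟩ := (preservesOvoid_of_mem g.2).eq_of_lowerMatrix_mul F8.pow_eight hw hab
    (congrArg (fun g : Sz8 => g.1.1) h)
  exact ⟨p, q, Units.mk0 c hc, ext_matrix e⟩

lemma diag_eq_one {c : F8ˣ} : diag c = 1 ↔ c = 1 := by
  refine ⟨fun h => ?_, fun h => by rw [h, diag_one]⟩
  have h' := diag_mul_lower c 1 0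
  rw [h, one_mul, mul_one (lower _ _), lower_inj, mul_one (_⁻¹)] at h'
  ext
  rw [Units.val_one, ← inv_inj, inv_one, ← h'.1]

/-- `g` is some `S(p, q) M(c)`, and commuting with `S(0, 1)` forces `c ^ 2 = 1`, so `c = 1`. -/
lemma exists_eq_lower_of_commute {g : Sz8} (h : Commute g (lower 0 1)) :
    ∃ a b, g = lower a b := by
  obtain ⟨p, q, c, rfl⟩ := eq_lower_mul_diag (by simp) h.eq.symm
  refine ⟨p, q, ?_⟩
  have h' : diag c * lower 0 1 = lower 0 1 * diag c := by
    have := h.eq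
    rw [mul_assoc, ← mul_assoc (lower 0 1), lower_mul] at this
    rw [← mul_right_inj (lower p q), this, ← mul_assoc, lower_mul]
    ring_nf
  rw [diag_mul_lower, mul_left_inj, lower_inj, mul_one ((c : F8) ^ 2)] at h'
  have hc : (c : F8) = 1 := by
    rw [← F8.pow_eight c]
    linear_combination ((c : F8) ^ 6 + c ^ 4 + c ^ 2 + 1) * h'.2
  rw [Units.val_eq_one.1 hc, diag_one, mul_one]

lemma lower_mul_diag_conj (p q a b : F8)
    (c : F8ˣ) :
    (lower p q * diag c) * lower a b * (lower p q * diag c)⁻¹ =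
      lower ((c : F8)⁻¹ * a)
        ((c : F8) ^ 2 * b + p ^ 4 * ((c : F8)⁻¹ * a) +
          p * ((c : F8)⁻¹ * a) ^ 4) := by
  rw [mul_inv_eq_iff_eq_mul, mul_assoc, diag_mul_lower, ← mul_assoc, ← mul_assoc, mul_left_inj,
    lower_mul, lower_mul, lower_inj]
  have h2 : (2 : F8) = 0 := CharTwo.two_eq_zero
  constructor
  · ring
  · linear_combination (-p * ((c : F8)⁻¹ * a) ^ 4) * h2

lemma lower_commute (a b c : F8) : Commute (lower a b) (lower 0 c) := by
  unfold Commute SemiconjBy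
  rw [lower_mul, lower_mul, lower_inj]
  constructor <;> ring

/-- `S(1, 1)` is the inverse of `S(1, 0)`. A relation between conjugates of `S(1, 0)` by powers of
some `t = M(w⁻¹)` would hold for `S(1, 1)` and `α t`; since `α t` again has the form `S(p, q) M(c)`,
this is an equation over F₈ without solutions. -/
lemma map_lower_ne (α : Sz8 ≃* Sz8) : α (lower 1 0) ≠ lower 1 1 := by
  intro hα
  have h2 : (2 : F8) = 0 := CharTwo.two_eq_zero
  obtain ⟨w, hw⟩ := F8.exists_primitive
  have hw0 : w ≠ 0 := by rintro rfl; simp at hw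
  have w7 := pow_seven_eq_one F8.pow_eight hw0
  have hz : α (lower 0 1) = lower 0 1 := by
    have h1 : lower 0 1 = lower 1 0 * lower 1 0 := by rw [lower_mul_self, one_pow]
    rw [h1, map_mul, hα, lower_mul_self, lower_mul_self]
  set t : Sz8 := diag (Units.mk0 w hw0)⁻¹ with ht
  have conj_t (a b : F8) : t * lower a b * t⁻¹ = lower (w * a) (w ^ 5 * b) := by
    rw [mul_inv_eq_iff_eq_mul, ht, diag_mul_lower]
    congr 2
    · simp
    · simp only [Units.val_inv_eq_inv_val, Units.val_mk0]
      field_simp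
      linear_combination -b * w7
  -- The conjugates by `1`, `t`, `t ^ 3` have first coordinates `1`, `w`, `w ^ 3`, which sum to
  -- zero.
  have rel : lower 1 0 * (t * lower 1 0 * t⁻¹) *
      (t * (t * (t * lower 1 0 * t⁻¹) * t⁻¹) * t⁻¹) = 1 := by
    rw [conj_t, conj_t, conj_t, lower_mul, lower_mul, lower_eq_one]
    have : w ^ 6 = w ^ 2 + 1 := by grind
    constructor <;> grind
  obtain ⟨a, b, hab⟩ : ∃ a b, α (t * lower 0 1 * t⁻¹) = lower a b := by
    apply exists_eq_lower_of_commute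
    rw [conj_t, ← hz, mul_zero]
    exact (lower_commute _ _ _).map α
  have hne : ¬(a = 0 ∧ b = 0) := by
    rw [← lower_eq_one, ← hab, map_eq_one_iff α α.injective, conj_eq_one_iff, lower_eq_one]
    simp
  obtain ⟨p, q, c, hc⟩ := eq_lower_mul_diag (g := α t) (a' := 0) (b' := 1) hne (by
    rw [← hab, map_mul, map_mul, hz, map_inv, inv_mul_cancel_right])
  have rel' := congrArg α rel
  simp only [map_mul, map_inv, map_one, hα, hc] at rel'
  have hcd : (c : F8) ^ 2 = (c : F8)⁻¹ ^ 5 := by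
    have := pow_seven_eq_one F8.pow_eight c.ne_zero
    have hc0 := c.ne_zero
    field_simp
    exact this
  have hd : (c : F8)⁻¹ ≠ 0 := inv_ne_zero c.ne_zero
  simp only [lower_mul_diag_conj, hcd] at rel'
  generalize (c : F8)⁻¹ = d at rel' hd
  rw [lower_mul, lower_mul, lower_eq_one] at rel'
  refine false_of_inverted_relation F8.pow_eight hd (p := p) ?_ ?_
  · linear_combination rel'.1
  · linear_combination rel'.2

/-- No automorphism of `Sz(8)` inverts an element `S(a, b)` of order four. -/
lemma map_lower_ne_inv (α : Sz8 ≃* Sz8) {a : F8} (ha : a ≠ 0) (b : F8) :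
    α (lower a b) ≠ (lower a b)⁻¹ := by
  have h2 : (2 : F8) = 0 := CharTwo.two_eq_zero
  intro hα
  -- Conjugation by `M(a)` gives `S(1, e)`, and then by `S(e ^ 4, 0)` adds `e ^ 2 + e ^ 4`. The
  -- result `s` is the trace of `e`, so it is 0 or 1.
  set e : F8 := a ^ 2 * b with he
  set g : Sz8 := lower (e ^ 4) 0 * diag (Units.mk0 a ha) with hg
  set s : F8 := e + e ^ 2 + e ^ 4 with hs
  have h8 := F8.pow_eight e
  have hconj : g * lower a b * g⁻¹ = lower 1 s := by
    rw [hg, lower_mul_diag_conj, Units.val_mk0, inv_mul_cancel₀ ha, ← he, lower_inj]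
    exact ⟨rfl, by grind⟩
  have hss : s = 0 ∨ s = 1 := by
    have : s * (s - 1) = 0 := by grind
    rcases mul_eq_zero.1 this with h | h
    · exact Or.inl h
    · exact Or.inr (sub_eq_zero.1 h)
  have hβ : ((MulAut.conj g⁻¹).trans α).trans (MulAut.conj g) (lower 1 s) = (lower 1 s)⁻¹ := by
    rw [← hconj]
    simp [mul_assoc, hα]
  rw [lower_inv, one_pow] at hβ
  rcases hss with h | h
  · rw [h, zero_add] at hβ
    exact map_lower_ne _ hβ
  · rw [h, CharTwo.add_self_eq_zero] at hβ
    exact map_lower_ne _ (by rw [← hβ, MulEquiv.symm_apply_apply])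

lemma diag_pow (c : F8ˣ) (n : ℕ) : diag c ^ n = diag (c ^ n) := by
  induction n with
  | zero => rw [pow_zero, pow_zero, diag_one]
  | succ n ih => rw [pow_succ, ih, diag_mul, pow_succ]

lemma diag_pow_seven (c : F8ˣ) : diag c ^ 7 = 1 := by
  rw [diag_pow, diag_eq_one]
  ext
  exact pow_seven_eq_one F8.pow_eight c.ne_zero

lemma lower_pow_four (a b : F8) : lower a b ^ 4 = 1 := by
  rw [pow_succ, pow_three', lower_mul_self, mul_assoc, lower_mul_self, lower_mul_self,
    lower_eq_one]
  simp

lemma lower_pow_seven_ne_one {a : F8} (ha : a ≠ 0) (b : F8) : lower a b ^ 7 ≠ 1 := by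
  intro h
  have : lower a b = (lower a b ^ 4) ^ 2 * (lower a b ^ 7)⁻¹ := by group
  rw [lower_pow_four, h] at this
  simp at this
  exact ha (lower_eq_one.1 this).1

lemma exists_eq_diag_of_commute {g : Sz8} {c : F8ˣ} (hc : c ≠ 1) (h : Commute g (diag c)) :
    ∃ d, g = diag d := by
  obtain ⟨w, hw⟩ := F8.exists_primitive
  have hcol {i j : Fin 4} (hij : i ≠ j) : g.1.1 i j = 0 :=
    apply_eq_zero_of_commute_diagMatrix F8.pow_eight c.ne_zero (by simpa using hc)
      (congrArg (fun g : Sz8 => g.1.1) h.eq) hij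
  obtain ⟨d, hd, e⟩ := (preservesOvoid_of_mem g.2).eq_diagMatrix F8.pow_eight hw
    (m := g.1.1 0 0) (l := g.1.1 3 3)
    (by ext i; fin_cases i <;> simp [Matrix.mulVec, dotProduct, Fin.sum_univ_four, hcol])
    (by ext i; fin_cases i <;> simp [Matrix.mulVec, dotProduct, Fin.sum_univ_four, hcol])
  exact ⟨Units.mk0 d hd, ext_matrix e⟩

end Sz8
end Suzuki

/-! ### Commuting graphs of orbits. -/

/-- In an `F`-graph two triangles cannot share an edge. -/
lemma SimpleGraph.IsFGraph.false_of_diamond {V : Type*} {Γ : SimpleGraph V} (h : Γ.IsFGraph)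
    {a b c d : V} (hab : Γ.Adj a b) (hac : Γ.Adj a c) (had : Γ.Adj a d) (hbc : Γ.Adj b c)
    (hbd : Γ.Adj b d) (hcd : c ≠ d) : False := by
  obtain ⟨hfin, -, hsub⟩ := h
  have ha : 3 ≤ (Γ.neighborSet a).ncard := by
    rw [← Set.ncard_eq_three.2 ⟨b, c, d, hbc.ne, hbd.ne, hcd, rfl⟩]
    refine Set.ncard_le_ncard ?_
    rintro v (rfl | rfl | rfl) <;> assumption
  have hb : 3 ≤ (Γ.neighborSet b).ncard := by
    rw [← Set.ncard_eq_three.2 ⟨a, c, d, hac.ne, had.ne, hcd, rfl⟩]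
    refine Set.ncard_le_ncard ?_
    rintro v (rfl | rfl | rfl)
    exacts [hab.symm, hbc, hbd]
  exact hab.ne (hsub ha hb)

section OrbitGraph
variable {G : Type*} [Group G] {A : Subgroup (MulAut G)}

/-- The vertex of the commuting graph of `A`-orbits given by a nonidentity element. -/
def NontrivialOrbit.of (A : Subgroup (MulAut G)) (x : G) (hx : x ≠ 1) : NontrivialOrbit G A :=
  ⟨MulAction.orbit A x, x, hx, rfl⟩

lemma NontrivialOrbit.of_ne_of {x y : G} (hx : x ≠ 1) (hy : y ≠ 1)
    (h : ∀ α ∈ A, α x ≠ y) : NontrivialOrbit.of A x hx ≠ NontrivialOrbit.of A y hy := by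
  intro e
  have : y ∈ MulAction.orbit A x := by
    rw [show MulAction.orbit A x = MulAction.orbit A y from congrArg Subtype.val e]
    exact MulAction.mem_orbit_self y
  obtain ⟨α, hα⟩ := this
  exact h α.1 α.2 hα

lemma commutingOrbitGraph_adj_of {x y : G} (hx : x ≠ 1) (hy : y ≠ 1)
    (h : ∀ α ∈ A, α x ≠ y) (hxy : Commute x y) :
    (commutingOrbitGraph G A).Adj (NontrivialOrbit.of A x hx) (NontrivialOrbit.of A y hy) :=
  ⟨NontrivialOrbit.of_ne_of hx hy h, x, MulAction.mem_orbit_self x, y,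
    MulAction.mem_orbit_self y, hxy⟩

/-- If the commuting graph of `A`-orbits is connected, an `A`-invariant set of elements that is
closed under commuting contains all nonidentity elements or none. -/
lemma mem_of_commutingOrbitGraph_connected (h : (commutingOrbitGraph G A).Connected) (D : Set G)
    (hA : ∀ α ∈ A, ∀ g ∈ D, α g ∈ D)
    (hD : ∀ g ∈ D, ∀ y, y ≠ 1 → Commute g y → y ∈ D) {x y : G} (hx : x ≠ 1) (hxD : x ∈ D)
    (hy : y ≠ 1) : y ∈ D := by
  have key : ∀ O P : NontrivialOrbit G A, (commutingOrbitGraph G A).Walk O P →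
      O.1 ⊆ D → P.1 ⊆ D := by
    intro O P w
    induction w with
    | nil => exact id
    | @cons O P Q hOP _ ih =>
      intro hO
      refine ih ?_
      obtain ⟨-, g, hg, k, hk, hgk⟩ := hOP
      obtain ⟨p, hp, hP⟩ := P.2
      have hk' := hk
      rw [hP] at hk'
      obtain ⟨β, rfl⟩ := hk'
      have hkD : β • p ∈ D := hD g (hO hg) _ (fun e => hp ((MulEquiv.map_eq_one_iff β.1).1 e)) hgk
      rw [hP, ← MulAction.orbit_smul β p]
      rintro _ ⟨α, rfl⟩
      exact hA α.1 α.2 _ hkD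
  obtain ⟨w⟩ := h.preconnected (NontrivialOrbit.of A x hx) (NontrivialOrbit.of A y hy)
  refine key _ _ w ?_ (MulAction.mem_orbit_self y)
  rintro _ ⟨α, rfl⟩
  exact hA α.1 α.2 _ hxD

end OrbitGraph

/-! ### Fixed-point-free and coprime action. -/

/-- An element that acts on a finite group as a fixed-point-free involution inverts it. -/
lemma Subgroup.conj_eq_inv_of_fixedPointFree {G : Type*} [Group G] (U : Subgroup G) [Finite U]
    {g : G} (hU : ∀ u ∈ U, g * u * g⁻¹ ∈ U) (hsq : ∀ u ∈ U, Commute (g * g) u)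
    (hfix : ∀ u ∈ U, Commute g u → u = 1) {u : G} (hu : u ∈ U) : g * u * g⁻¹ = u⁻¹ := by
  -- By finiteness every `u` is of the form `v⁻¹ * (g * v * g⁻¹)`, an expression that `g` inverts
  -- because `g * g` centralizes `v`.
  have hinj : Function.Injective
      (fun v : U => (⟨v.1⁻¹ * (g * v.1 * g⁻¹), U.mul_mem (U.inv_mem v.2) (hU _ v.2)⟩ : U)) := by
    intro v v' e
    have e' : v.1⁻¹ * (g * v.1 * g⁻¹) = v'.1⁻¹ * (g * v'.1 * g⁻¹) := congrArg Subtype.val e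
    have h1 := hfix (v'.1 * v.1⁻¹) (U.mul_mem v'.2 (U.inv_mem v.2)) (by
      have e2 : v'.1 * v.1⁻¹ = (g * v'.1 * g⁻¹) * (g * v.1 * g⁻¹)⁻¹ := by
        rw [eq_mul_inv_iff_mul_eq, mul_assoc, e', mul_inv_cancel_left]
      unfold Commute SemiconjBy
      nth_rewrite 2 [e2]
      group)
    exact Subtype.ext (mul_inv_eq_one.1 h1).symm
  obtain ⟨v, hv⟩ := (Finite.injective_iff_surjective.1 hinj) ⟨u, hu⟩
  have hv' : v.1⁻¹ * (g * v.1 * g⁻¹) = u := congrArg Subtype.val hv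
  have hs : g * g * v.1 * g⁻¹ * g⁻¹ = v.1 := by
    have := (hsq _ v.2).eq
    rw [this]
    group
  rw [← hv']
  calc _ = (g * v.1 * g⁻¹)⁻¹ * (g * g * v.1 * g⁻¹ * g⁻¹) := by group
    _ = _ := by rw [hs]; group

/-- A surjective homomorphism of finite groups whose kernel and image have coprime orders
splits. -/
lemma MonoidHom.exists_section_of_coprime {H P : Type*} [Group H] [Group P] [Finite H]
    (f : H →* P) (hf : Function.Surjective f) (hcop : (Nat.card f.ker).Coprime (Nat.card P)) :
    ∃ φ : P →* H, ∀ p, f (φ p) = p := by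
  have hidx : f.ker.index = Nat.card P := by
    rw [Subgroup.index_ker, MonoidHom.range_eq_top.2 hf, Subgroup.card_top]
  obtain ⟨C, hC⟩ := Subgroup.exists_right_complement'_of_coprime (N := f.ker) (by rwa [hidx])
  have hbij : Function.Bijective (f.comp C.subtype) := by
    constructor
    · rw [injective_iff_map_eq_one]
      intro c hc
      have := Subgroup.disjoint_def.1 hC.disjoint (x := c.1) hc c.2
      exact Subtype.ext this
    · intro p
      obtain ⟨h, rfl⟩ := hf p
      obtain ⟨⟨k, c⟩, rfl⟩ := hC.2 h
      exact ⟨c, by simp [MonoidHom.mem_ker.1 k.2]⟩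
  let e := MulEquiv.ofBijective (f.comp C.subtype) hbij
  exact ⟨C.subtype.comp e.symm.toMonoidHom, fun p => e.apply_symm_apply p⟩

lemma MonoidHom.exists_lift_of_coprime {G Q : Type*} [Group G] [Group Q] [Finite G]
    (π : G →* Q) (hπ : Function.Surjective π) (P : Subgroup Q)
    (hcop : (Nat.card π.ker).Coprime (Nat.card P)) :
    ∃ φ : P →* G, ∀ p, π (φ p) = p := by
  let f := π.subgroupComap P
  have hker : Nat.card f.ker ∣ Nat.card π.ker := by
    have : f.ker.map (P.comap π).subtype ≤ π.ker := by
      rintro _ ⟨x, hx, rfl⟩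
      exact congrArg Subtype.val (MonoidHom.mem_ker.1 hx)
    rw [← Subgroup.card_map_of_injective (P.comap π).subtype_injective]
    exact Subgroup.card_dvd_of_le this
  obtain ⟨φ, hφ⟩ := f.exists_section_of_coprime
    (π.subgroupComap_surjective_of_surjective P hπ) (hcop.coprime_dvd_left hker)
  exact ⟨(P.comap π).subtype.comp φ, fun p => congrArg Subtype.val (hφ p)⟩

/-- A `p`-group that has no nontrivial fixed points under an element of `p`-power order has order
prime to `p`. -/
lemma Subgroup.not_dvd_card_of_fixedPointFree {G : Type*} [Group G] [Finite G] (N : Subgroup G)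
    [N.Normal] (p : ℕ) [Fact p.Prime] {x : G} {k : ℕ} (hx : x ^ p ^ k = 1)
    (hfix : ∀ n ∈ N, Commute x n → n = 1) : ¬ p ∣ Nat.card N := by
  intro hdvd
  have hP : IsPGroup p (Subgroup.zpowers x) := by
    rintro ⟨_, m, rfl⟩
    refine ⟨k, Subtype.ext ?_⟩
    change (x ^ m) ^ p ^ k = 1
    rw [← zpow_natCast, ← zpow_mul, mul_comm, zpow_mul, zpow_natCast, hx, one_zpow]
  let _ : MulAction (Subgroup.zpowers x) N :=
    MulAction.compHom N ((MulAut.conjNormal (H := N)).comp (Subgroup.zpowers x).subtype)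
  have hact (g : Subgroup.zpowers x) (n : N) : ((g • n : N) : G) = g.1 * n.1 * g.1⁻¹ := rfl
  obtain ⟨b, hb, hne⟩ := hP.exists_fixed_point_of_prime_dvd_card_of_fixed_point N hdvd
    (a := 1) (fun g => Subtype.ext (by rw [hact]; simp))
  have hb' := congrArg Subtype.val (hb ⟨x, Subgroup.mem_zpowers x⟩)
  rw [hact, mul_inv_eq_iff_eq_mul] at hb'
  exact hne (Subtype.ext (hfix _ b.2 hb').symm)

/-! ### Extensions of Sz(8). -/

namespace Suzuki
namespace Sz8

/-- The subgroup of all elements `S(a, b)` of `Sz(8)`. -/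
def lowerSubgroup : Subgroup Sz8 where
  carrier := {g | ∃ a b, g = lower a b}
  mul_mem' := by
    rintro _ _ ⟨a, b, rfl⟩ ⟨c, d, rfl⟩
    exact ⟨_, _, lower_mul a b c d⟩
  one_mem' := ⟨0, 0, lower_zero.symm⟩
  inv_mem' := by
    rintro _ ⟨a, b, rfl⟩
    exact ⟨_, _, lower_inv a b⟩

lemma isPGroup_lowerSubgroup : IsPGroup 2 lowerSubgroup := by
  rintro ⟨_, a, b, rfl⟩
  exact ⟨2, Subtype.ext (lower_pow_four a b)⟩

lemma exists_ne : ∃ w : F8, w ≠ 0 ∧ w ≠ 1 := by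
  obtain ⟨w, hw⟩ := F8.exists_primitive
  refine ⟨w, ?_, ?_⟩ <;> rintro rfl
  · simp at hw
  · rw [one_pow] at hw
    exact one_ne_zero (add_eq_right.1 hw.symm)

section Extension
variable {G : Type*} [Group G]

lemma not_connected_of_mulEquiv (e : G ≃* Sz8) (A : Subgroup (MulAut G)) :
    ¬ (commutingOrbitGraph G A).Connected := by
  intro h
  obtain ⟨w, hw0, hw1⟩ := exists_ne
  set c : F8ˣ := Units.mk0 w hw0
  have hc : c ≠ 1 := fun h => hw1 (congrArg Units.val h)
  -- Ranging over all isomorphisms makes `D` invariant under every automorphism of `G`.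
  let D : Set G := {g | ∃ (α : G ≃* Sz8) (d : F8ˣ), d ≠ 1 ∧ α g = diag d}
  have hne {d : F8ˣ} (hd : d ≠ 1) : e.symm (diag d) ≠ 1 := by
    rwa [Ne, MulEquiv.map_eq_one_iff, diag_eq_one]
  have hmem : e.symm (lower 1 0) ∈ D := by
    refine mem_of_commutingOrbitGraph_connected h D ?_ ?_ (hne hc)
      ⟨e, c, hc, e.apply_symm_apply _⟩ ?_
    · rintro β - g ⟨α, d, hd, hg⟩
      exact ⟨β.symm.trans α, d, hd, by simpa using hg⟩
    · rintro g ⟨α, d, hd, hg⟩ y hy hgy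
      obtain ⟨d', hd'⟩ := exists_eq_diag_of_commute hd (g := α y)
        (by rw [← hg]; exact (hgy.map α).symm)
      refine ⟨α, d', ?_, hd'⟩
      rintro rfl
      rw [diag_one, MulEquiv.map_eq_one_iff] at hd'
      exact hy hd'
    · rw [Ne, MulEquiv.map_eq_one_iff, lower_eq_one]
      exact fun h => one_ne_zero h.1
  obtain ⟨α, d, -, hd⟩ := hmem
  apply lower_pow_seven_ne_one (one_ne_zero (α := F8)) 0
  rw [← MulEquiv.map_eq_one_iff (e.symm.trans α), map_pow, MulEquiv.trans_apply, hd,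
    diag_pow_seven]

variable {π : G →* Sz8}

/-- If every element over some `S(a, b)` of order four acts fixed point freely on the kernel of a
surjection to `Sz(8)`, then this kernel is trivial. -/
lemma ker_eq_bot_of_fixedPointFree [Finite G] (hπ : Function.Surjective π)
    (H : ∀ x a b, a ≠ 0 → π x = lower a b → ∀ n ∈ π.ker, Commute x n → n = 1) : π.ker = ⊥ := by
  have h2 : (2 : F8) = 0 := CharTwo.two_eq_zero
  have hodd : ¬ 2 ∣ Nat.card π.ker := by
    obtain ⟨x, hx⟩ := hπ (lower 1 0)
    refine Subgroup.not_dvd_card_of_fixedPointFree π.ker 2 (x := x) (k := 2) ?_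
      (H x 1 0 one_ne_zero hx)
    -- `x ^ 4` lies in the kernel and commutes with `x`, so it is trivial.
    refine H x 1 0 one_ne_zero hx _ ?_ (Commute.refl x |>.pow_right _)
    rw [MonoidHom.mem_ker, map_pow, hx]
    exact lower_pow_four 1 0
  have : Fact (Nat.Prime 2) := ⟨Nat.prime_two⟩
  obtain ⟨k, hk⟩ := IsPGroup.iff_card.1 isPGroup_lowerSubgroup
  obtain ⟨φ, hφ⟩ := π.exists_lift_of_coprime hπ lowerSubgroup (by
    rw [hk]
    exact ((Nat.Prime.coprime_iff_not_dvd Nat.prime_two).2 hodd).symm.pow_right _)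
  let s (a b : F8) : G := φ ⟨lower a b, a, b, rfl⟩
  have π_s (a b : F8) : π (s a b) = lower a b := hφ _
  have s_mul (a b c d : F8) : s a b * s c d = s (a + c) (b + d + a ^ 4 * c) := by
    simp only [s]
    rw [← map_mul]
    congr 1
    exact Subtype.ext (lower_mul a b c d)
  have s_sq (a b : F8) : s a b * s a b = s 0 (a ^ 5) := by
    rw [s_mul, CharTwo.add_self_eq_zero, CharTwo.add_self_eq_zero, zero_add, ← pow_succ]
  have s_zero : s 0 0 = 1 := by
    simp only [s]
    rw [← map_one φ]
    congr 1
    exact Subtype.ext lower_zero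
  have free (a b : F8) (ha : a ≠ 0) (n : G) (hn : n ∈ π.ker) (h : Commute (s a b) n) : n = 1 :=
    H _ a b ha (π_s a b) n hn h
  -- On the centralizer of `s a b ^ 2` in the kernel, `s a b` acts as a fixed-point-free involution.
  have inverts (a b : F8) (ha : a ≠ 0) (n : G) (hn : n ∈ π.ker)
      (h : Commute (s 0 (a ^ 5)) n) : s a b * n * (s a b)⁻¹ = n⁻¹ := by
    refine (π.ker ⊓ Subgroup.centralizer {s 0 (a ^ 5)}).conj_eq_inv_of_fixedPointFree
      (fun u hu => Subgroup.mem_inf.2 ⟨(inferInstance : π.ker.Normal).conj_mem _ hu.1 _, ?_⟩)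
      (fun u hu => ?_)
      (fun u hu => free a b ha u hu.1) ⟨hn, Subgroup.mem_centralizer_singleton_iff.2 h.eq.symm⟩
    · rw [Subgroup.mem_centralizer_singleton_iff]
      have hu' : Commute u (s 0 (a ^ 5)) := Subgroup.mem_centralizer_singleton_iff.1 hu.2
      have hs : Commute (s a b) (s 0 (a ^ 5)) := by
        rw [← s_sq a b]
        exact (Commute.refl _).mul_right (Commute.refl _)
      exact (hs.mul_left hu').mul_left hs.inv_left
    · rw [s_sq]
      exact (Subgroup.mem_centralizer_singleton_iff.1 hu.2 : Commute _ _).symm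
  have commute_of_inverts {g h n : G} (hg : g * n * g⁻¹ = n⁻¹) (hh : h * n * h⁻¹ = n⁻¹) :
      Commute (g * h) n := by
    unfold Commute SemiconjBy
    rw [← mul_inv_eq_iff_eq_mul, mul_inv_rev]
    calc _ = g * (h * n * h⁻¹) * g⁻¹ := by group
      _ = (g * n * g⁻¹)⁻¹ := by rw [hh]; group
      _ = _ := by rw [hg, inv_inv]
  obtain ⟨w, hw0, hw1⟩ := exists_ne
  have central (c : F8) (hc : c ≠ 0) (n : G) (hn : n ∈ π.ker) (h : Commute (s 0 c) n) :
      n = 1 := by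
    -- Thus every `s (c ^ 3) b` is a square root of `s 0 c` and inverts `n`. Products of two of them
    -- give all `s 0 d`, which therefore centralize `n`.
    have hc3 : (c ^ 3) ^ 5 = c := by
      linear_combination (c ^ 7 + 1) * F8.pow_eight c
    have hinv (b : F8) := inverts (c ^ 3) b (pow_ne_zero _ hc) n hn (by rwa [hc3])
    have hcen (d : F8) : Commute (s 0 d) n := by
      have := commute_of_inverts (hinv (d + c ^ 15)) (hinv 0)
      rwa [s_mul, CharTwo.add_self_eq_zero, add_zero,
        show d + c ^ 15 + (c ^ 3) ^ 4 * c ^ 3 = d + (c ^ 15 + c ^ 15) by ring,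
        CharTwo.add_self_eq_zero, add_zero] at this
    -- Now every `s a b` with `a ≠ 0` inverts `n`, but `s 1 0 * s w 0` is again of this type, since
    -- `1 + w ≠ 0`, and centralizes `n`.
    have hcom := commute_of_inverts (inverts 1 0 one_ne_zero n hn (hcen _))
      (inverts w 0 hw0 n hn (hcen _))
    rw [s_mul] at hcom
    refine free _ _ (fun e => hw1 ?_) n hn hcom
    linear_combination e - h2
  have inverts' (c : F8) (hc : c ≠ 0) (n : G) (hn : n ∈ π.ker) :
      s 0 c * n * (s 0 c)⁻¹ = n⁻¹ := by
    refine π.ker.conj_eq_inv_of_fixedPointFree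
      (fun u hu => (inferInstance : π.ker.Normal).conj_mem _ hu _) (fun u _ => ?_)
      (fun u hu => central c hc u hu) hn
    rw [s_sq, zero_pow (by norm_num), s_zero]
    exact Commute.one_left u
  refine (Subgroup.eq_bot_iff_forall _).2 fun n hn => ?_
  -- The same contest among the involutions: `s 0 1` and `s 0 w` invert `n`, while their product `s
  -- 0 (1 + w)` centralizes it.
  have hcom := commute_of_inverts (inverts' 1 one_ne_zero n hn) (inverts' w hw0 n hn)
  rw [s_mul, zero_add] at hcom
  refine central _ (fun e => hw1 ?_) n hn hcom
  linear_combination e - h2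

lemma fixedPointFree_of_isFGraph {A : Subgroup (MulAut G)}
    (hA : ∀ α ∈ A, ∃ β : Sz8 ≃* Sz8, ∀ g, π (α g) = β (π g))
    (hΓ : (commutingOrbitGraph G A).IsFGraph) {x : G} {a b : F8} (ha : a ≠ 0)
    (hx : π x = lower a b) {n : G} (hn : n ∈ π.ker) (hxn : Commute x n) : n = 1 := by
  by_contra hn1
  have hx1 : π x ≠ 1 := by rw [hx, Ne, lower_eq_one]; exact fun h => ha h.1
  have hx4 : (π x * π x) * (π x * π x) = 1 := by
    rw [hx, lower_mul_self, lower_mul_self, lower_eq_one]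
    simp
  have hx2 : π x * π x ≠ 1 := by
    rw [hx, lower_mul_self, Ne, lower_eq_one]
    exact fun h => ha (by simpa using h.2)
  have ne1 {g : G} (h : π g ≠ 1) : g ≠ 1 := by rintro rfl; exact h (map_one π)
  have hxi : π x⁻¹ ≠ 1 := by rw [map_inv]; exact inv_ne_one.2 hx1
  have hxx : π (x * x) ≠ 1 := by rw [map_mul]; exact hx2
  have toKer {g : G} (h : π g ≠ 1) : ∀ α ∈ A, α g ≠ n := by
    intro α hα e
    obtain ⟨β, hβ⟩ := hA α hα
    have := hβ g
    rw [e, MonoidHom.mem_ker.1 hn, eq_comm, MulEquiv.map_eq_one_iff] at this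
    exact h this
  -- The image of `x * x` has square 1, unlike that of `g`.
  have toSq {g : G} (h : π g * π g ≠ 1) : ∀ α ∈ A, α g ≠ x * x := by
    intro α hα e
    obtain ⟨β, hβ⟩ := hA α hα
    have h' := hβ g
    rw [e, map_mul] at h'
    apply h
    rw [← MulEquiv.map_eq_one_iff β, map_mul, ← h', hx4]
  have toInv : ∀ α ∈ A, α x ≠ x⁻¹ := by
    intro α hα e
    obtain ⟨β, hβ⟩ := hA α hα
    have h' := hβ x
    rw [e, map_inv, hx] at h'
    exact map_lower_ne_inv β ha b h'.symm
  have hxi2 : π x⁻¹ * π x⁻¹ ≠ 1 := by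
    rw [map_inv, ← mul_inv_rev]; exact inv_ne_one.2 hx2
  have c1 : Commute x x := Commute.refl x
  exact hΓ.false_of_diamond
    (commutingOrbitGraph_adj_of (ne1 hx1) (ne1 hxi) toInv c1.inv_right)
    (commutingOrbitGraph_adj_of (ne1 hx1) (ne1 hxx) (toSq hx2) (c1.mul_right c1))
    (commutingOrbitGraph_adj_of (ne1 hx1) hn1 (toKer hx1) hxn)
    (commutingOrbitGraph_adj_of (ne1 hxi) (ne1 hxx) (toSq hxi2) (c1.mul_right c1).inv_left)
    (commutingOrbitGraph_adj_of (ne1 hxi) hn1 (toKer hxi) hxn.inv_left)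
    (NontrivialOrbit.of_ne_of (ne1 hxx) hn1 (toKer hxx))

end Extension
end Sz8
end Suzuki

theorem mainTheorem8 {G : Type*} [Group G] [Finite G] (N : Subgroup G) [N.Characteristic]
    (hN : Nonempty (G ⧸ N ≃* Suzuki.Sz8)) :
    ¬ ∃ A : Subgroup (MulAut G), (commutingOrbitGraph G A).IsFGraph := by
  rintro ⟨A, hΓ⟩
  obtain ⟨e⟩ := hN
  let π : G →* Suzuki.Sz8 := e.toMonoidHom.comp (QuotientGroup.mk' N)
  have hπ : Function.Surjective π := e.surjective.comp (QuotientGroup.mk'_surjective N)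
  have hA : ∀ α ∈ A, ∃ β : Suzuki.Sz8 ≃* Suzuki.Sz8, ∀ g, π (α g) = β (π g) := by
    intro α _
    have hα : N.map α.toMonoidHom = N := Subgroup.characteristic_iff_map_eq.1 inferInstance α
    refine ⟨(e.symm.trans (QuotientGroup.congr N N α hα)).trans e, fun g => ?_⟩
    simp only [π, MonoidHom.comp_apply, MulEquiv.trans_apply, MulEquiv.toMonoidHom_eq_coe,
      MonoidHom.coe_coe, MulEquiv.symm_apply_apply, QuotientGroup.mk'_apply]
    rfl
  have hker : π.ker = ⊥ := Suzuki.Sz8.ker_eq_bot_of_fixedPointFree hπ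
    fun x a b ha hx n hn => Suzuki.Sz8.fixedPointFree_of_isFGraph hA hΓ ha hx hn
  exact Suzuki.Sz8.not_connected_of_mulEquiv
    (MulEquiv.ofBijective π ⟨(MonoidHom.ker_eq_bot_iff π).1 hker, hπ⟩) A hΓ.2.1
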